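/- For a positive integer $n$, let $p(n)$ denote the number of partitions of $n$, i.e. the number of ways to write $n$ as a sum of positive integers, where the order of the summands is disregarded. Then $$\lim_{n\to\infty}\frac{p(n)}{\dfrac{1}{4n\sqrt{3}}\exp\left(\pi\sqrt{\dfrac{2n}{3}}\right)}=1.$$ -/

import Mathlib

/-- `partitionCount n` is the number of partitions of `n`, that is, the number of ways to write `n`
as a sum of positive integers, the order of the summands being disregarded. -/
def partitionCount (n : ℕ) : ℕ := Fintype.card (Nat.Partition n)

/-!
The proof is a saddle point argument on Cauchy's formula. Writing `φ(q) = ∏ (1 - q ^ k)`, Euler's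
identity `∑ p(n) q ^ n = 1 / φ(q)` (`hasSum_partitionCount_mul_pow`) gives
`2 π p(n) = ∫ exp (n s) / φ(exp (-s)) dθ` over `s = σ + θ * I`, `|θ| ≤ π`, for every `σ > 0`
(`integral_inv_eulerPhi`).

Near the positive axis the integrand is known precisely: up to the factor `exp (-s / 24)`, `φ(exp (-s))`
is the Dedekind eta function at `s * I / (2 π)`, and its behaviour under `z ↦ -1 / z` reads
`1 / φ(exp (-s)) = √(s / 2π) * exp (π² / (6 s) - s / 24) / φ(exp (-4 π² / s))`
(`eulerPhi_transformation`). As `s → 0` near the axis the last factor tends to `1`. The exponent `π² / (6 s) + n s`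
has its saddle point at `σ = π / √(6 n)`. With `σ = τ²` and `θ = τ³ u` the integrand, divided by
`√(σ / 2π) * exp (π √(2 n / 3))`, converges to `exp (-π² u² / 6)` for each fixed `u`
(`tendsto_scaledIntegrand`).

A single estimate on the whole circle justifies passing to the limit under the integral: comparing
the logarithms of `1 / φ(q)` and `1 / φ(‖q‖)` term by term gives
`‖φ(q)‖ ≥ φ(‖q‖) * exp (1 / (1 - ‖q‖) - re (1 / (1 - q)))` (`norm_eulerPhi_mul_exp_le`), and in the
variable `u` this exponential makes the integrand `O (1 / (1 + u²))` uniformly in `τ`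
(`norm_scaledIntegrand_le`). There is thus no separate treatment of minor arcs, and `p(n)` is
asymptotic to `τ⁴ / (2 π √(2 π)) * exp (π √(2 n / 3))` times the Gaussian integral `√(6 / π)`, which is
the asserted main term.
-/

open Filter Topology Finset

/-! ### The Euler function -/

/-- The Euler function `φ(q) = ∏_{k ≥ 1} (1 - q ^ k)`, the reciprocal of the generating function of
the partition numbers. -/
noncomputable def eulerPhi (q : ℂ) : ℂ := ∏' k : ℕ, (1 - q ^ (k + 1))

theorem tendsto_prod_eulerPhi {q : ℂ} (hq : ‖q‖ < 1) :
    Tendsto (fun N ↦ ∏ k ∈ range N, (1 - q ^ (k + 1))) atTop (𝓝 (eulerPhi q)) :=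
  (ModularForm.multipliable_one_sub_pow hq).hasProd.tendsto_prod_nat

theorem one_sub_pow_ne_zero {q : ℂ} (hq : ‖q‖ < 1) (k : ℕ) : 1 - q ^ (k + 1) ≠ 0 := by
  rw [sub_ne_zero]
  intro h
  have := congrArg norm h
  rw [norm_one, norm_pow] at this
  exact (pow_lt_one₀ (norm_nonneg q) hq k.succ_ne_zero).ne' this

theorem eulerPhi_ne_zero {q : ℂ} (hq : ‖q‖ < 1) : eulerPhi q ≠ 0 := by
  unfold eulerPhi
  simp_rw [sub_eq_add_neg]
  refine tprod_one_add_ne_zero_of_summable (f := fun n : ℕ ↦ -q ^ (n + 1)) (fun k ↦ ?_) ?_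
  · simpa [sub_eq_add_neg] using one_sub_pow_ne_zero hq k
  · simpa using (summable_nat_add_iff 1).mpr (summable_geometric_of_lt_one (norm_nonneg _) hq)

/-! ### The generating function of the partition numbers -/

/-- The formal power series `f` converges absolutely at `q`, with sum `a`. -/
def PowerSeries.EvaluatesTo (f : PowerSeries ℂ) (q a : ℂ) : Prop :=
  Summable (fun n ↦ ‖f.coeff n * q ^ n‖) ∧ HasSum (fun n ↦ f.coeff n * q ^ n) a

theorem PowerSeries.EvaluatesTo.mul {f g : PowerSeries ℂ} {q a b : ℂ}
    (hf : f.EvaluatesTo q a) (hg : g.EvaluatesTo q b) : (f * g).EvaluatesTo q (a * b) := by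
  have key : ∀ n, (f * g).coeff n * q ^ n =
      ∑ kl ∈ antidiagonal n, (f.coeff kl.1 * q ^ kl.1) * (g.coeff kl.2 * q ^ kl.2) := by
    intro n
    rw [PowerSeries.coeff_mul, sum_mul]
    refine sum_congr rfl fun kl hkl ↦ ?_
    rw [← mem_antidiagonal.mp hkl, pow_add]
    ring
  have hs := summable_norm_sum_mul_antidiagonal_of_summable_norm hf.1 hg.1
  refine ⟨by simpa only [key] using hs, ?_⟩
  simp only [key]
  rw [← hf.2.tsum_eq, ← hg.2.tsum_eq, tsum_mul_tsum_eq_tsum_sum_antidiagonal_of_summable_norm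
    hf.1 hg.1]
  exact hs.of_norm.hasSum

theorem PowerSeries.EvaluatesTo.one (q : ℂ) : (1 : PowerSeries ℂ).EvaluatesTo q 1 := by
  have h : ∀ n, (1 : PowerSeries ℂ).coeff n * q ^ n = if n = 0 then 1 else 0 := by
    intro n
    rw [PowerSeries.coeff_one]
    split_ifs with hn <;> simp [hn]
  refine ⟨?_, ?_⟩
  · simp only [h]
    exact summable_of_ne_finset_zero (s := {0}) (by simp +contextual)
  · simp only [h]
    exact hasSum_ite_eq 0 1

open PowerSeries.WithPiTopology in
theorem PowerSeries.EvaluatesTo.tsum_X_pow {q : ℂ} (hq : ‖q‖ < 1) (k : ℕ) :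
    (∑' j : ℕ, PowerSeries.X ^ ((k + 1) * j) : PowerSeries ℂ).EvaluatesTo q
      (1 - q ^ (k + 1))⁻¹ := by
  have hs : Summable fun j : ℕ ↦ (PowerSeries.X ^ ((k + 1) * j) : PowerSeries ℂ) := by
    simp_rw [pow_mul]
    exact summable_pow_of_constantCoeff_eq_zero (by simp)
  have hc : ∀ n, (∑' j : ℕ, PowerSeries.X ^ ((k + 1) * j) : PowerSeries ℂ).coeff n =
      if k + 1 ∣ n then 1 else 0 := by
    intro n
    rw [hs.map_tsum _ (PowerSeries.WithPiTopology.continuous_coeff _ _)]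
    simp_rw [PowerSeries.coeff_X_pow]
    split_ifs with h
    · obtain ⟨m, rfl⟩ := h
      rw [tsum_eq_single m]
      · simp
      · intro b hb
        simp [hb.symm]
    · refine (tsum_congr fun j ↦ ?_).trans tsum_zero
      rw [if_neg]
      rintro rfl
      exact h (Dvd.intro _ rfl)
  have hinj : Function.Injective fun j : ℕ ↦ (k + 1) * j :=
    fun a b h ↦ Nat.eq_of_mul_eq_mul_left k.succ_pos h
  have hq' : ‖q ^ (k + 1)‖ < 1 := by
    rw [norm_pow]
    exact pow_lt_one₀ (norm_nonneg q) hq k.succ_ne_zero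
  constructor
  · simp only [hc]
    refine Summable.of_nonneg_of_le (fun _ ↦ norm_nonneg _) (fun n ↦ ?_)
      (summable_geometric_of_lt_one (norm_nonneg q) hq)
    split_ifs
    · simp
    · simp
  · simp only [hc]
    rw [← hinj.hasSum_iff]
    · simpa [Function.comp_def, pow_mul] using hasSum_geometric_of_norm_lt_one hq'
    · intro n hn
      rw [if_neg, zero_mul]
      rintro ⟨m, rfl⟩
      exact hn ⟨m, rfl⟩

open PowerSeries.WithPiTopology in
/-- Partitions into parts of size at most `N` are generated by `∏_{k ≤ N} (1 - q ^ k)⁻¹`. -/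
theorem evaluatesTo_card_restricted_le {q : ℂ} (hq : ‖q‖ < 1) (N : ℕ) :
    (PowerSeries.mk fun n ↦ (#(Nat.Partition.restricted n (· ≤ N)) : ℂ)).EvaluatesTo q
      (∏ k ∈ range N, (1 - q ^ (k + 1)))⁻¹ := by
  rw [Nat.Partition.powerSeriesMk_card_restricted_eq_tprod, tprod_eq_prod (s := range N)]
  · rw [← prod_inv_distrib]
    have : ∀ M ≤ N, (∏ i ∈ range M, if i + 1 ≤ N then ∑' j : ℕ, PowerSeries.X ^ ((i + 1) * j)
        else (1 : PowerSeries ℂ)).EvaluatesTo q (∏ k ∈ range M, (1 - q ^ (k + 1))⁻¹) := by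
      intro M
      induction M with
      | zero => exact fun _ ↦ by simpa using .one q
      | succ M ih =>
        intro hM
        rw [prod_range_succ, prod_range_succ, if_pos hM]
        exact (ih (by lia)).mul (.tsum_X_pow hq M)
    exact this N le_rfl
  · intro i hi
    rw [if_neg]
    simpa using hi

theorem card_restricted_le (n N : ℕ) :
    #(Nat.Partition.restricted n (· ≤ N)) ≤ partitionCount n :=
  card_le_univ _

theorem card_restricted_eq {n N : ℕ} (h : n ≤ N) :
    #(Nat.Partition.restricted n (· ≤ N)) = partitionCount n := by
  rw [partitionCount, ← card_univ]
  congr 1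
  ext p
  simp only [Nat.Partition.restricted, mem_filter, mem_univ, true_and, iff_true]
  exact fun i hi ↦ (p.parts_sum ▸ Multiset.le_sum_of_mem hi).trans h

/-- The partial sum up to `N` counts only partitions into parts of size at most `N`, so it is bounded
by a partial product of `1 / φ(r)`; these partial products converge. -/
theorem summable_partitionCount_mul_pow {r : ℝ} (h0 : 0 ≤ r) (h1 : r < 1) :
    Summable fun n ↦ (partitionCount n : ℝ) * r ^ n := by
  have hr : ‖(r : ℂ)‖ < 1 := by rwa [Complex.norm_of_nonneg h0]
  have ht := ((tendsto_prod_eulerPhi hr).inv₀ (eulerPhi_ne_zero hr)).norm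
  obtain ⟨C, hC⟩ := ht.bddAbove_range
  refine summable_of_sum_range_le (c := C) (fun n ↦ by positivity) fun N ↦ ?_
  obtain ⟨hs, he⟩ := evaluatesTo_card_restricted_le hr N
  have hn : ∀ n, ‖(PowerSeries.mk fun n ↦ (#(Nat.Partition.restricted n (· ≤ N)) : ℂ)).coeff n *
      (r : ℂ) ^ n‖ = #(Nat.Partition.restricted n (· ≤ N)) * r ^ n := by
    intro n
    simp [abs_of_nonneg h0]
  have he' : HasSum (fun n ↦ (#(Nat.Partition.restricted n (· ≤ N)) : ℝ) * r ^ n)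
      (‖(∏ k ∈ range N, (1 - (r : ℂ) ^ (k + 1)))⁻¹‖) := by
    simp only [hn] at hs
    have h2 := Complex.hasSum_ofReal.mpr hs.hasSum
    have h3 := h2.unique (he.congr_fun ?_)
    · rw [← h3, Complex.norm_of_nonneg (tsum_nonneg fun n ↦ by positivity)]
      exact hs.hasSum
    · intro n
      simp
  calc ∑ n ∈ range N, (partitionCount n : ℝ) * r ^ n
      = ∑ n ∈ range N, (#(Nat.Partition.restricted n (· ≤ N)) : ℝ) * r ^ n :=
        sum_congr rfl fun n hn ↦ by rw [card_restricted_eq (mem_range.mp hn).le]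
    _ ≤ _ := sum_le_hasSum _ (fun n _ ↦ by positivity) he'
    _ ≤ C := hC ⟨N, rfl⟩

/-- Euler's generating function: `∑ p(n) q ^ n = 1 / φ(q)` on the unit disc. -/
theorem hasSum_partitionCount_mul_pow {q : ℂ} (hq : ‖q‖ < 1) :
    HasSum (fun n ↦ (partitionCount n : ℂ) * q ^ n) (eulerPhi q)⁻¹ := by
  have hsum := summable_partitionCount_mul_pow (norm_nonneg q) hq
  have hsum' : Summable fun n ↦ (partitionCount n : ℂ) * q ^ n :=
    Summable.of_norm (by simpa using hsum)
  have hlim : Tendsto (fun N ↦ ∑' n, (#(Nat.Partition.restricted n (· ≤ N)) : ℂ) * q ^ n) atTop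
      (𝓝 (∑' n, (partitionCount n : ℂ) * q ^ n)) := by
    refine tendsto_tsum_of_dominated_convergence hsum (fun n ↦ ?_) (.of_forall fun N n ↦ ?_)
    · refine tendsto_const_nhds.congr' ?_
      filter_upwards [eventually_ge_atTop n] with N hN
      rw [card_restricted_eq hN]
    · rw [norm_mul, norm_pow, Complex.norm_natCast]
      gcongr
      exact card_restricted_le n N
  have hprod : ∀ N, ∑' n, (#(Nat.Partition.restricted n (· ≤ N)) : ℂ) * q ^ n =
      (∏ k ∈ range N, (1 - q ^ (k + 1)))⁻¹ := fun N ↦ by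
    simpa using (evaluatesTo_card_restricted_le hq N).2.tsum_eq
  simp only [hprod] at hlim
  rw [← tendsto_nhds_unique hlim ((tendsto_prod_eulerPhi hq).inv₀ (eulerPhi_ne_zero hq))]
  exact hsum'.hasSum

theorem integral_exp_int_mul (k : ℤ) :
    ∫ θ in (-Real.pi)..Real.pi, Complex.exp (k * Complex.I * (θ : ℂ)) =
      if k = 0 then 2 * (Real.pi : ℂ) else 0 := by
  split_ifs with h
  · subst h
    simp
    ring
  · rw [integral_exp_mul_complex (mul_ne_zero (by exact_mod_cast h) Complex.I_ne_zero)]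
    have hper : Complex.exp (k * Complex.I * (Real.pi : ℝ)) =
        Complex.exp (k * Complex.I * (-Real.pi : ℝ)) := by
      rw [Complex.exp_eq_exp_iff_exists_int]
      refine ⟨k, ?_⟩
      push_cast
      ring
    rw [hper]
    simp

/-- Cauchy's coefficient formula on the circle of radius `exp (-σ)`, for an absolutely convergent
power series. -/
theorem integral_hasSum_mul_exp {a : ℕ → ℂ} {f : ℂ → ℂ} {σ : ℝ}
    (hs : Summable fun m ↦ ‖a m‖ * Real.exp (-σ) ^ m)
    (hf : ∀ q, ‖q‖ = Real.exp (-σ) → HasSum (fun m ↦ a m * q ^ m) (f q)) (n : ℕ) :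
    ∫ θ in (-Real.pi)..Real.pi, f (Complex.exp (-(σ + θ * Complex.I))) *
      Complex.exp (n * (σ + θ * Complex.I)) = 2 * Real.pi * a n := by
  have hI : HasSum (fun m ↦ ∫ θ in (-Real.pi)..Real.pi, a m *
        Complex.exp (-(σ + θ * Complex.I)) ^ m * Complex.exp (n * (σ + θ * Complex.I)))
      (∫ θ in (-Real.pi)..Real.pi, f (Complex.exp (-(σ + θ * Complex.I))) *
        Complex.exp (n * (σ + θ * Complex.I))) := by
    refine intervalIntegral.hasSum_integral_of_dominated_convergence
      (fun m _ ↦ ‖a m‖ * Real.exp (-σ) ^ m * Real.exp (n * σ)) (fun m ↦ ?_)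
      (fun m ↦ .of_forall fun θ _ ↦ ?_) (.of_forall fun _ _ ↦ hs.mul_right _) (by simp)
      (.of_forall fun θ _ ↦ ?_)
    · exact Continuous.aestronglyMeasurable (by fun_prop)
    · simp [Complex.norm_exp]
    · exact (hf _ (by simp [Complex.norm_exp])).mul_right _
  have hFm : ∀ m, ∫ θ in (-Real.pi)..Real.pi, a m *
        Complex.exp (-(σ + θ * Complex.I)) ^ m * Complex.exp (n * (σ + θ * Complex.I)) =
      if m = n then 2 * Real.pi * a n else 0 := by
    intro m
    have hFe : ∀ θ : ℝ, a m *
        Complex.exp (-(σ + θ * Complex.I)) ^ m * Complex.exp (n * (σ + θ * Complex.I)) =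
        a m * Complex.exp (((n : ℂ) - m) * σ) *
        Complex.exp (((n - m : ℤ) : ℂ) * Complex.I * θ) := by
      intro θ
      rw [← Complex.exp_nat_mul, mul_assoc, mul_assoc, ← Complex.exp_add, ← Complex.exp_add]
      push_cast
      ring_nf
    simp only [hFe]
    rw [intervalIntegral.integral_const_mul, integral_exp_int_mul]
    by_cases h : m = n
    · subst h
      simp
      ring
    · rw [if_neg (by lia), if_neg h, mul_zero]
  simp only [hFm] at hI
  exact hI.unique (hasSum_ite_eq n _)

/-- The circle `‖q‖ = exp (-σ)` is parametrized by `q = exp (-s)` with `s = σ + θ * I`. -/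
theorem integral_inv_eulerPhi {σ : ℝ} (hσ : 0 < σ) (n : ℕ) :
    ∫ θ in (-Real.pi)..Real.pi, (eulerPhi (Complex.exp (-(σ + θ * Complex.I))))⁻¹ *
      Complex.exp (n * (σ + θ * Complex.I)) = 2 * Real.pi * partitionCount n := by
  have hr : Real.exp (-σ) < 1 := by simpa using hσ
  refine integral_hasSum_mul_exp (a := fun n ↦ (partitionCount n : ℂ))
    (f := fun q ↦ (eulerPhi q)⁻¹) ?_ (fun q hq ↦ hasSum_partitionCount_mul_pow (hq ▸ hr)) n
  simpa using summable_partitionCount_mul_pow (Real.exp_nonneg (-σ)) hr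

/-! ### Decay of the generating function away from the positive axis -/

/-- All terms of the series of `log ‖1 - z‖ - log (1 - ‖z‖)` are nonnegative; the right-hand side
retains only the linear one. -/
theorem exp_norm_sub_re_le {z : ℂ} (hz : ‖z‖ < 1) :
    (1 - ‖z‖) * Real.exp (‖z‖ - z.re) ≤ ‖1 - z‖ := by
  have hz' : ‖((‖z‖ : ℝ) : ℂ)‖ < 1 := by simpa using hz
  have hne : 1 - z ≠ 0 := by simpa using one_sub_pow_ne_zero hz 0
  have h := (Complex.hasSum_re (Complex.hasSum_taylorSeries_neg_log hz')).sub
    (Complex.hasSum_re (Complex.hasSum_taylorSeries_neg_log hz))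
  have hterm : ∀ n : ℕ, 0 ≤ ((((‖z‖ : ℝ) : ℂ) ^ n / n).re - (z ^ n / n).re) := by
    intro n
    rw [← Complex.ofReal_pow, Complex.div_natCast_re, Complex.div_natCast_re, Complex.ofReal_re,
      ← sub_div]
    have := Complex.re_le_norm (z ^ n)
    rw [norm_pow] at this
    exact div_nonneg (by linarith) n.cast_nonneg
  have h1 := le_hasSum h 1 fun n _ ↦ hterm n
  have hpos : 0 < 1 - ‖z‖ := by linarith
  have hcast : (1 : ℂ) - ((‖z‖ : ℝ) : ℂ) = ((1 - ‖z‖ : ℝ) : ℂ) := by push_cast; ring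
  simp only [pow_one, Nat.cast_one, div_one, Complex.ofReal_re, Complex.neg_re, Complex.log_re,
    hcast, Complex.norm_of_nonneg hpos.le] at h1
  calc (1 - ‖z‖) * Real.exp (‖z‖ - z.re)
      ≤ (1 - ‖z‖) * Real.exp (Real.log ‖1 - z‖ - Real.log (1 - ‖z‖)) :=
        mul_le_mul_of_nonneg_left (Real.exp_le_exp.mpr (by linarith)) hpos.le
    _ = ‖1 - z‖ := by
      rw [Real.exp_sub, Real.exp_log hpos, Real.exp_log (norm_pos_iff.mpr hne)]
      field_simp

/-- Multiplying the bounds for the single factors, the exponents `‖q‖ ^ k - re (q ^ k)` add up to a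
geometric series. -/
theorem norm_eulerPhi_mul_exp_le {q : ℂ} (hq : ‖q‖ < 1) :
    ‖eulerPhi ‖q‖‖ * Real.exp ((1 - ‖q‖)⁻¹ - ((1 - q)⁻¹).re) ≤ ‖eulerPhi q‖ := by
  have hq' : ‖((‖q‖ : ℝ) : ℂ)‖ < 1 := by simpa using hq
  have hg : HasSum (fun k : ℕ ↦ ‖q‖ ^ (k + 1) - (q ^ (k + 1)).re)
      ((1 - ‖q‖)⁻¹ - ((1 - q)⁻¹).re) := by
    have := (hasSum_geometric_of_lt_one (norm_nonneg q) hq).sub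
      (Complex.hasSum_re (hasSum_geometric_of_norm_lt_one hq))
    simpa using (hasSum_nat_add_iff' 1).mpr this
  refine le_of_tendsto_of_tendsto' ((tendsto_prod_eulerPhi hq').norm.mul
    ((Real.continuous_exp.tendsto _).comp hg.tendsto_sum_nat)) (tendsto_prod_eulerPhi hq).norm
    fun N ↦ ?_
  rw [Function.comp_apply, Real.exp_sum, norm_prod, norm_prod, ← prod_mul_distrib]
  refine prod_le_prod (fun _ _ ↦ by positivity) fun k _ ↦ ?_
  have hk : ‖q ^ (k + 1)‖ < 1 := by
    rw [norm_pow]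
    exact pow_lt_one₀ (norm_nonneg q) hq k.succ_ne_zero
  have h := exp_norm_sub_re_le hk
  rw [norm_pow] at h hk
  rwa [← Complex.ofReal_pow, ← Complex.ofReal_one, ← Complex.ofReal_sub,
    Complex.norm_of_nonneg (by linarith)]

/-- On the circle `‖q‖ = exp (-σ)` the exponent in `norm_eulerPhi_mul_exp_le` is, up to constants,
at least `min (θ² / σ³) (1 / σ)`. -/
theorem le_inv_one_sub_sub_re {σ θ : ℝ} (h0 : 0 < σ) (h1 : σ ≤ 1 / 2) (hθ : |θ| ≤ Real.pi) :
    θ ^ 2 / (10 * σ ^ 3 + 2 * σ * θ ^ 2) ≤ (1 - Real.exp (-σ))⁻¹ -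
      ((1 - Complex.exp (-(σ + θ * Complex.I)))⁻¹).re := by
  set r := Real.exp (-σ) with hr
  have hr1 : r < 1 := by simpa [hr] using h0
  have hrσ : 1 - σ ≤ r := by linarith [Real.add_one_le_exp (-σ)]
  set w := r * (1 - Real.cos θ) with hw
  have hcos := Real.cos_le_one_sub_mul_cos_sq hθ
  have hpi : Real.pi ^ 2 < 10 := by nlinarith [Real.pi_lt_d2, Real.pi_pos]
  have hw0 : θ ^ 2 / 10 ≤ w := by
    have h3 : θ ^ 2 / 10 ≤ θ ^ 2 / Real.pi ^ 2 := by gcongr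
    have h4 : 2 * (θ ^ 2 / Real.pi ^ 2) ≤ 1 - Real.cos θ := by
      have : 2 / Real.pi ^ 2 * θ ^ 2 = 2 * (θ ^ 2 / Real.pi ^ 2) := by ring
      linarith
    have h5 : 0 ≤ θ ^ 2 / Real.pi ^ 2 := by positivity
    nlinarith
  have hw1 : 0 ≤ w := le_trans (by positivity) hw0
  have hre : (Complex.exp (-(σ + θ * Complex.I))).re = r - w := by
    simp [Complex.exp_re, hw, hr]
    ring
  have him : (Complex.exp (-(σ + θ * Complex.I))).im = - (r * Real.sin θ) := by
    simp [Complex.exp_im, hr]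
  have hn : Complex.normSq (1 - Complex.exp (-(σ + θ * Complex.I))) = (1 - r) ^ 2 + 2 * w := by
    rw [Complex.normSq_apply, Complex.sub_re, Complex.sub_im, hre, him, Complex.one_re,
      Complex.one_im, hw]
    linear_combination r ^ 2 * Real.sin_sq_add_cos_sq θ
  rw [Complex.inv_re, hn, Complex.sub_re, hre, Complex.one_re]
  have ha : 0 < 1 - r := by linarith
  have ha' : 1 - r ≤ σ := by linarith
  -- Here `‖1 - q‖² = (1 - r)² + 2 w`. Up to the factor `1 + r ≥ 1`, the difference is increasing in
  -- `w` and decreasing in `1 - r`, so `w` may be replaced by `θ² / 10` and `1 - r` by `σ`.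
  have e1 : (1 - r)⁻¹ - (1 - (r - w)) / ((1 - r) ^ 2 + 2 * w) =
      w * (1 + r) / ((1 - r) * ((1 - r) ^ 2 + 2 * w)) := by
    have : 0 < (1 - r) ^ 2 + 2 * w := by positivity
    field_simp
    ring
  rw [e1]
  calc θ ^ 2 / (10 * σ ^ 3 + 2 * σ * θ ^ 2) ≤ w / (σ * (σ ^ 2 + 2 * w)) := by
        rw [div_le_div_iff₀ (by positivity) (by positivity)]
        have : 0 ≤ σ ^ 3 * (w - θ ^ 2 / 10) := mul_nonneg (by positivity) (by linarith)
        nlinarith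
    _ ≤ w / ((1 - r) * ((1 - r) ^ 2 + 2 * w)) := by gcongr
    _ ≤ _ := by
        gcongr
        have : 0 < r := Real.exp_pos _
        nlinarith

/-- In the variables `σ = τ²`, `θ = τ³ u` the decay is dominated by an integrable function of `u`,
uniformly in `τ`. -/
theorem exp_neg_le_div_one_add_sq {τ u : ℝ} (hτ : 0 < τ) (hu : |τ ^ 3 * u| ≤ Real.pi) :
    Real.exp (-((τ ^ 3 * u) ^ 2 / (10 * (τ ^ 2) ^ 3 + 2 * τ ^ 2 * (τ ^ 3 * u) ^ 2))) ≤
      25920 * (1 + u ^ 2)⁻¹ := by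
  have hpi : Real.pi ^ 2 < 10 := by nlinarith [Real.pi_lt_d2, Real.pi_pos]
  -- The exponent is `u² / (10 + 2 X)`, and `|θ| ≤ π` limits `X` to the order of `|u| ^ (4 / 3)`; its
  -- cube is then at least of order `u²`, and the cubic term of the exponential series suffices.
  set X := τ ^ 2 * u ^ 2 with hX
  have hX0 : 0 ≤ X := by positivity
  have hX3 : X ^ 3 ≤ 10 * u ^ 4 := by
    have h := pow_le_pow_left₀ (abs_nonneg _) hu 2
    rw [sq_abs] at h
    calc X ^ 3 = (τ ^ 3 * u) ^ 2 * u ^ 4 := by rw [hX]; ring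
      _ ≤ 10 * u ^ 4 := by gcongr; linarith
  have hy : (τ ^ 3 * u) ^ 2 / (10 * (τ ^ 2) ^ 3 + 2 * τ ^ 2 * (τ ^ 3 * u) ^ 2) =
      u ^ 2 / (10 + 2 * X) := by
    rw [hX]
    field_simp
  rw [hy]
  set y := u ^ 2 / (10 + 2 * X) with hy'
  have hy0 : 0 ≤ y := by positivity
  have hexp : 1 + y ^ 3 / 6 ≤ Real.exp y := by
    have h := Real.sum_le_exp_of_nonneg hy0 4
    simp [sum_range_succ, Nat.factorial] at h
    nlinarith [sq_nonneg y]
  have hmain : (1 + u ^ 2) / 25920 ≤ Real.exp y := by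
    refine le_trans ?_ hexp
    rcases le_total (u ^ 2) 1 with h | h
    · have : 0 ≤ y ^ 3 / 6 := by positivity
      linarith
    · have hc : (10 + 2 * X) ^ 3 ≤ 4320 * u ^ 4 := by
        have h4 : 1 ≤ u ^ 4 := by nlinarith
        have : 0 ≤ (10 + 2 * X) * (10 - 2 * X) ^ 2 := by positivity
        nlinarith
      have hy3 : u ^ 2 / 4320 ≤ y ^ 3 := by
        rw [hy', div_pow, div_le_div_iff₀ (by norm_num) (by positivity)]
        have : 0 ≤ u ^ 2 := by positivity
        nlinarith [mul_le_mul_of_nonneg_left hc this]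
      linarith
  rw [Real.exp_neg, ← div_eq_mul_inv, inv_le_comm₀ (Real.exp_pos y) (by positivity), inv_div]
  exact hmain

/-! ### The transformation formula -/

/-- The functional equation of the Dedekind eta function under `z ↦ -1 / z`, at
`z = s * I / (2 * π)`. -/
theorem eulerPhi_transformation {s : ℂ} (hs : 0 < s.re) :
    Complex.exp (-(Real.pi ^ 2 / (6 * s))) * eulerPhi (Complex.exp (-(4 * Real.pi ^ 2 / s))) =
      (Complex.sqrt Complex.I)⁻¹ * (Complex.sqrt (s * Complex.I / (2 * Real.pi)) *
        (Complex.exp (-(s / 24)) * eulerPhi (Complex.exp (-s)))) := by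
  have hs0 : s ≠ 0 := by
    rintro rfl
    simp at hs
  have hpi : (Real.pi : ℂ) ≠ 0 := by exact_mod_cast Real.pi_ne_zero
  have heta : ∀ z : ℂ, ModularForm.eta z = Complex.exp (2 * Real.pi * Complex.I * z / 24) *
      eulerPhi (Complex.exp (2 * Real.pi * Complex.I * z)) := by
    intro z
    simp [ModularForm.eta, eulerPhi, Function.Periodic.qParam, ModularForm.eta_q_eq_pow]
  have hz : s * Complex.I / (2 * Real.pi) ∈ UpperHalfPlane.upperHalfPlaneSet := by
    change 0 < (s * Complex.I / (2 * Real.pi)).im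
    have : s * Complex.I / (2 * Real.pi) = s * Complex.I / ((2 * Real.pi : ℝ) : ℂ) := by
      push_cast; rfl
    rw [this, Complex.div_ofReal_im]
    simp
    positivity
  have h := ModularForm.eta_comp_eq_csqrt_I_inv hz
  simp only [Function.comp_apply, Pi.smul_apply, Pi.mul_apply, smul_eq_mul, heta] at h
  have e1 : 2 * Real.pi * Complex.I * (s * Complex.I / (2 * Real.pi)) = -s := by
    field_simp
    simp
  have e2 : 2 * Real.pi * Complex.I * (-1 / (s * Complex.I / (2 * Real.pi))) =
      -(4 * Real.pi ^ 2 / s) := by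
    field_simp
    ring
  have e3 : -(4 * (Real.pi : ℂ) ^ 2 / s) / 24 = -(Real.pi ^ 2 / (6 * s)) := by
    field_simp
    ring
  rw [e1, e2, e3, neg_div] at h
  exact h

/-! ### The rescaled integrand and its limit -/

/-- The point `σ + θ * I` with `σ = τ²` and `θ = τ³ u`: in the variable `u` the peak of the
generating function at the positive axis has bounded width as `τ → 0`. -/
noncomputable def scaledPoint (τ u : ℝ) : ℂ :=
  ((τ ^ 2 : ℝ) : ℂ) + ((τ ^ 3 * u : ℝ) : ℂ) * Complex.I

/-- Cauchy's integrand `exp (n s) / φ (exp (-s))` at `s = scaledPoint τ u`, for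
`n = π² / (6 τ⁴)`, divided by its order of magnitude at `u = 0`. -/
noncomputable def scaledIntegrand (τ u : ℝ) : ℂ :=
  (eulerPhi (Complex.exp (-scaledPoint τ u)))⁻¹ *
    Complex.exp (((Real.pi ^ 2 / (6 * τ ^ 4) : ℝ) : ℂ) * scaledPoint τ u) /
    ((τ / Real.sqrt (2 * Real.pi) * Real.exp (Real.pi ^ 2 / (3 * τ ^ 2)) : ℝ) : ℂ)

theorem scaledPoint_re (τ u : ℝ) : (scaledPoint τ u).re = τ ^ 2 := by
  simp [scaledPoint, -Complex.ofReal_pow, -Complex.ofReal_mul]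

theorem scaledPoint_eq (τ u : ℝ) : scaledPoint τ u = τ ^ 2 * (1 + τ * u * Complex.I) := by
  simp [scaledPoint]
  ring

theorem one_add_mul_I_ne_zero (x : ℝ) : 1 + (x : ℂ) * Complex.I ≠ 0 := by
  intro h
  simpa using congrArg Complex.re h

theorem norm_exp_neg_scaledPoint (τ u : ℝ) :
    ‖Complex.exp (-scaledPoint τ u)‖ = Real.exp (-τ ^ 2) := by
  rw [Complex.norm_exp, Complex.neg_re, scaledPoint_re]

theorem norm_exp_neg_scaledPoint_lt_one {τ : ℝ} (hτ : 0 < τ) (u : ℝ) :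
    ‖Complex.exp (-scaledPoint τ u)‖ < 1 := by
  rw [norm_exp_neg_scaledPoint, Real.exp_lt_one_iff]
  have : 0 < τ ^ 2 := by positivity
  linarith

theorem continuous_scaledIntegrand {τ : ℝ} (hτ : 0 < τ) : Continuous (scaledIntegrand τ) := by
  have hs : Continuous (scaledPoint τ) := by unfold scaledPoint; fun_prop
  have hφ : Continuous fun u ↦ eulerPhi (Complex.exp (-scaledPoint τ u)) :=
    ModularForm.differentiableOn_tprod_one_sub_pow.continuousOn.comp_continuous
      (Complex.continuous_exp.comp hs.neg)
      fun u ↦ by simpa using norm_exp_neg_scaledPoint_lt_one hτ u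
  unfold scaledIntegrand
  exact ((hφ.inv₀ fun u ↦ eulerPhi_ne_zero (norm_exp_neg_scaledPoint_lt_one hτ u)).mul
    (Complex.continuous_exp.comp (continuous_const.mul hs))).div_const _

/-- A positive real factor may be taken out of the principal square root. -/
theorem sqrt_scaledPoint {τ : ℝ} (hτ : 0 < τ) (u : ℝ) :
    Complex.sqrt (scaledPoint τ u * Complex.I / (2 * Real.pi)) =
      ((τ / Real.sqrt (2 * Real.pi) : ℝ) : ℂ) *
        Complex.sqrt ((1 + τ * u * Complex.I) * Complex.I) := by
  have h : scaledPoint τ u * Complex.I / (2 * Real.pi) =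
      (((τ / Real.sqrt (2 * Real.pi)) ^ 2 : ℝ) : ℂ) *
        ((1 + τ * u * Complex.I) * Complex.I) := by
    rw [scaledPoint_eq, div_pow, Real.sq_sqrt (by positivity)]
    push_cast
    ring
  have hne : (1 + (τ : ℂ) * u * Complex.I) * Complex.I ≠ 0 :=
    mul_ne_zero (by simpa using one_add_mul_I_ne_zero (τ * u)) Complex.I_ne_zero
  have hpos : 0 < τ / Real.sqrt (2 * Real.pi) := by positivity
  have hpos2 := pow_pos hpos 2
  rw [h, _root_.sqrt_eq_exp (mul_ne_zero (by exact_mod_cast hpos2.ne') hne),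
    _root_.sqrt_eq_exp hne, Complex.log_ofReal_mul hpos2 hne, Real.log_pow, add_div,
    Complex.exp_add]
  congr 1
  push_cast
  rw [mul_div_cancel_left₀ _ two_ne_zero, ← Complex.ofReal_div, ← Complex.ofReal_exp,
    Real.exp_log hpos]

theorem norm_exp_neg_div_lt_one {s : ℂ} (hs : 0 < s.re) :
    ‖Complex.exp (-(4 * Real.pi ^ 2 / s))‖ < 1 := by
  have h : 4 * (Real.pi : ℂ) ^ 2 / s = ((4 * Real.pi ^ 2 : ℝ) : ℂ) * s⁻¹ := by
    push_cast
    rw [div_eq_mul_inv]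
  have hs0 : s ≠ 0 := by
    rintro rfl
    simp at hs
  have hn := Complex.normSq_pos.mpr hs0
  rw [Complex.norm_exp, h, Complex.neg_re, Complex.re_ofReal_mul, Complex.inv_re,
    Real.exp_lt_one_iff, neg_lt_zero]
  positivity

/-- The choice `n = π² / (6 τ⁴)` makes `s = τ²` the saddle point of `π² / (6 s) + n s`, so that the
exponent is quadratic in `u`. -/
theorem scaledIntegrand_eq {τ : ℝ} (hτ : 0 < τ) (u : ℝ) :
    scaledIntegrand τ u = (Complex.sqrt Complex.I)⁻¹ *
      Complex.sqrt ((1 + τ * u * Complex.I) * Complex.I) *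
      Complex.exp (-(scaledPoint τ u / 24)) *
      Complex.exp (-(Real.pi ^ 2 / 6 * u ^ 2 / (1 + τ * u * Complex.I))) /
      eulerPhi (Complex.exp (-(4 * Real.pi ^ 2 / scaledPoint τ u))) := by
  have hre : 0 < (scaledPoint τ u).re := by rw [scaledPoint_re]; positivity
  have h := eulerPhi_transformation hre
  rw [sqrt_scaledPoint hτ] at h
  have hs0 : scaledPoint τ u ≠ 0 := by
    intro h0
    simp [h0] at hre
  have h1 : 1 + (τ : ℂ) * u * Complex.I ≠ 0 := by simpa using one_add_mul_I_ne_zero (τ * u)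
  have hτ0 : (τ : ℂ) ≠ 0 := by exact_mod_cast hτ.ne'
  have hφ1 := eulerPhi_ne_zero (norm_exp_neg_scaledPoint_lt_one hτ u)
  have hφ2 : eulerPhi (Complex.exp (-(4 * Real.pi ^ 2 / scaledPoint τ u))) ≠ 0 :=
    eulerPhi_ne_zero (norm_exp_neg_div_lt_one hre)
  have hexp : Complex.exp (((Real.pi ^ 2 / (6 * τ ^ 4) : ℝ) : ℂ) * scaledPoint τ u) =
      Complex.exp (-(Real.pi ^ 2 / 6 * u ^ 2 / (1 + τ * u * Complex.I))) *
      Complex.exp (Real.pi ^ 2 / (3 * τ ^ 2)) *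
      Complex.exp (-(Real.pi ^ 2 / (6 * scaledPoint τ u))) := by
    rw [← Complex.exp_add, ← Complex.exp_add, scaledPoint_eq]
    congr 1
    push_cast
    field_simp
    ring_nf
    simp only [Complex.I_sq]
    ring
  have hne : ((τ / Real.sqrt (2 * Real.pi) : ℝ) : ℂ) ≠ 0 := by
    exact_mod_cast (by positivity : τ / Real.sqrt (2 * Real.pi) ≠ 0)
  have hE : (Complex.exp (Real.pi ^ 2 / (3 * τ ^ 2))) ≠ 0 := Complex.exp_ne_zero _
  unfold scaledIntegrand
  rw [hexp, Complex.ofReal_mul, div_eq_div_iff (mul_ne_zero hne (by exact_mod_cast hE)) hφ2]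
  push_cast at h ⊢
  rw [mul_assoc, inv_mul_eq_iff_eq_mul₀ hφ1]
  linear_combination Complex.exp (-(Real.pi ^ 2 / 6 * u ^ 2 / (1 + τ * u * Complex.I))) *
      Complex.exp (Real.pi ^ 2 / (3 * τ ^ 2)) * h

/-- As `τ → 0` with `u` fixed, `re (1 / s)` tends to infinity and `exp (-4 π² / s)` to `0`, so that the
transformed factor disappears in the limit. -/
theorem tendsto_eulerPhi_inversion (u : ℝ) :
    Tendsto (fun τ : ℝ ↦ eulerPhi (Complex.exp (-(4 * Real.pi ^ 2 / scaledPoint τ u))))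
      (𝓝[>] 0) (𝓝 1) := by
  have h0 : eulerPhi 0 = 1 := by simp [eulerPhi]
  have hc : ContinuousAt eulerPhi 0 :=
    (ModularForm.differentiableOn_tprod_one_sub_pow.differentiableAt
      (Metric.isOpen_ball.mem_nhds (by simp))).continuousAt
  rw [← h0]
  refine hc.tendsto.comp (tendsto_zero_iff_norm_tendsto_zero.mpr ?_)
  have hnorm : ∀ τ : ℝ, ‖Complex.exp (-(4 * Real.pi ^ 2 / scaledPoint τ u))‖ =
      Real.exp (-(4 * Real.pi ^ 2 * (τ ^ 2 * (1 + (τ * u) ^ 2))⁻¹)) := by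
    intro τ
    have : 4 * (Real.pi : ℂ) ^ 2 / scaledPoint τ u =
        ((4 * Real.pi ^ 2 * (τ ^ 2 * (1 + (τ * u) ^ 2))⁻¹ : ℝ) : ℂ) *
          (1 - ((τ * u : ℝ) : ℂ) * Complex.I) := by
      rw [scaledPoint_eq]
      rcases eq_or_ne τ 0 with rfl | hτ
      · simp
      have hτ0 : (τ : ℂ) ≠ 0 := by exact_mod_cast hτ
      have h1 : 1 + (τ : ℂ) * u * Complex.I ≠ 0 := by simpa using one_add_mul_I_ne_zero (τ * u)
      have h2 : 1 + ((τ : ℂ) * u) ^ 2 ≠ 0 := by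
        exact_mod_cast (by positivity : 1 + (τ * u) ^ 2 ≠ 0)
      have h3 : 1 + (τ : ℂ) ^ 2 * u ^ 2 ≠ 0 := by rwa [← mul_pow]
      push_cast
      rw [div_eq_iff (by positivity), mul_pow]
      field_simp
      ring_nf
      simp only [Complex.I_sq]
      ring
    rw [Complex.norm_exp, this, Complex.neg_re, Complex.re_ofReal_mul]
    simp [-Complex.ofReal_mul]
  simp only [hnorm]
  refine Real.tendsto_exp_neg_atTop_nhds_zero.comp
    (Tendsto.const_mul_atTop (by positivity) (tendsto_inv_nhdsGT_zero.comp ?_))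
  refine tendsto_nhdsWithin_iff.mpr ⟨?_, ?_⟩
  · have : Continuous fun τ : ℝ ↦ τ ^ 2 * (1 + (τ * u) ^ 2) := by fun_prop
    simpa using (this.tendsto 0).mono_left nhdsWithin_le_nhds
  · filter_upwards [self_mem_nhdsWithin] with τ hτ
    have : (0 : ℝ) < τ := hτ
    exact Set.mem_Ioi.mpr (by positivity)

theorem tendsto_scaledIntegrand (u : ℝ) :
    Tendsto (fun τ ↦ scaledIntegrand τ u) (𝓝[>] 0)
      (𝓝 ((Real.exp (-(Real.pi ^ 2 / 6) * u ^ 2) : ℝ) : ℂ)) := by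
  have hI : Complex.sqrt Complex.I ≠ 0 := by simp [Complex.sqrt]
  have h1 : Tendsto (fun τ : ℝ ↦ Complex.sqrt ((1 + τ * u * Complex.I) * Complex.I)) (𝓝[>] 0)
      (𝓝 (Complex.sqrt Complex.I)) := by
    have hc : ContinuousAt Complex.sqrt Complex.I := Complex.continuousAt_sqrt (by simp)
    have : Continuous fun τ : ℝ ↦ (1 + (τ : ℂ) * u * Complex.I) * Complex.I := by fun_prop
    refine hc.tendsto.comp ?_
    simpa using (this.tendsto 0).mono_left nhdsWithin_le_nhds
  have h2 : Tendsto (fun τ : ℝ ↦ Complex.exp (-(scaledPoint τ u / 24))) (𝓝[>] 0) (𝓝 1) := by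
    have : Continuous fun τ : ℝ ↦ Complex.exp (-(scaledPoint τ u / 24)) := by
      unfold scaledPoint
      fun_prop
    simpa [scaledPoint] using (this.tendsto 0).mono_left nhdsWithin_le_nhds
  have h3 : Tendsto (fun τ : ℝ ↦
      Complex.exp (-(Real.pi ^ 2 / 6 * u ^ 2 / (1 + τ * u * Complex.I)))) (𝓝[>] 0)
      (𝓝 ((Real.exp (-(Real.pi ^ 2 / 6) * u ^ 2) : ℝ) : ℂ)) := by
    have : Continuous fun τ : ℝ ↦
        Complex.exp (-((Real.pi : ℂ) ^ 2 / 6 * u ^ 2 / (1 + τ * u * Complex.I))) := by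
      refine Complex.continuous_exp.comp (Continuous.neg (Continuous.div (by fun_prop)
        (by fun_prop) fun τ ↦ by simpa using one_add_mul_I_ne_zero (τ * u)))
    simpa using (this.tendsto 0).mono_left nhdsWithin_le_nhds
  have h := (((h1.const_mul (Complex.sqrt Complex.I)⁻¹).mul h2).mul h3).div
    (tendsto_eulerPhi_inversion u) one_ne_zero
  rw [inv_mul_cancel₀ hI, one_mul, one_mul, div_one] at h
  refine h.congr' ?_
  filter_upwards [self_mem_nhdsWithin] with τ hτ
  exact (scaledIntegrand_eq hτ u).symm

/-- The factor `exp (n s)` has the same modulus along the whole circle, so the decay of the generating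
function passes to the integrand. -/
theorem norm_scaledIntegrand_le {τ u : ℝ} (hτ : 0 < τ) (hτ1 : τ ^ 2 ≤ 1 / 2)
    (hu : |τ ^ 3 * u| ≤ Real.pi) :
    ‖scaledIntegrand τ u‖ ≤ ‖scaledIntegrand τ 0‖ * (25920 * (1 + u ^ 2)⁻¹) := by
  have hq := norm_exp_neg_scaledPoint_lt_one hτ u
  have h1 := norm_eulerPhi_mul_exp_le hq
  have h2 := le_inv_one_sub_sub_re (by positivity : 0 < τ ^ 2) hτ1 hu
  have h3 := exp_neg_le_div_one_add_sq hτ hu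
  have hq0 : ((‖Complex.exp (-scaledPoint τ u)‖ : ℝ) : ℂ) = Complex.exp (-scaledPoint τ 0) := by
    rw [norm_exp_neg_scaledPoint]
    simp [scaledPoint]
  have hφ0 := norm_pos_iff.mpr (eulerPhi_ne_zero (norm_exp_neg_scaledPoint_lt_one hτ 0))
  rw [hq0, norm_exp_neg_scaledPoint] at h1
  set δ := (1 - Real.exp (-τ ^ 2))⁻¹ - ((1 - Complex.exp (-scaledPoint τ u))⁻¹).re with hδ
  have h4 : ‖eulerPhi (Complex.exp (-scaledPoint τ u))‖⁻¹ ≤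
      ‖eulerPhi (Complex.exp (-scaledPoint τ 0))‖⁻¹ * (25920 * (1 + u ^ 2)⁻¹) := by
    calc _ ≤ (‖eulerPhi (Complex.exp (-scaledPoint τ 0))‖ * Real.exp δ)⁻¹ := by gcongr
      _ = ‖eulerPhi (Complex.exp (-scaledPoint τ 0))‖⁻¹ * Real.exp (-δ) := by
        rw [mul_inv, Real.exp_neg]
      _ ≤ _ := by
        gcongr
        exact (Real.exp_le_exp.mpr (neg_le_neg h2)).trans h3
  have hre : ∀ v, ‖Complex.exp (((Real.pi ^ 2 / (6 * τ ^ 4) : ℝ) : ℂ) * scaledPoint τ v)‖ =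
      Real.exp (Real.pi ^ 2 / (6 * τ ^ 4) * τ ^ 2) := by
    intro v
    rw [Complex.norm_exp, Complex.re_ofReal_mul, scaledPoint_re]
  simp only [scaledIntegrand, norm_div, norm_mul, norm_inv, hre]
  exact (div_le_div_of_nonneg_right (mul_le_mul_of_nonneg_right h4 (Real.exp_nonneg _))
    (norm_nonneg _)).trans_eq (by ring)

/-- The limit is the Gaussian integral `∫ exp (-π² u² / 6) du`; `norm_scaledIntegrand_le` gives the
domination on the whole circle at once. -/
theorem tendsto_integral_scaledIntegrand :
    Tendsto (fun τ : ℝ ↦ ∫ u in (-Real.pi / τ ^ 3)..(Real.pi / τ ^ 3), scaledIntegrand τ u)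
      (𝓝[>] 0) (𝓝 ((Real.sqrt (6 / Real.pi) : ℝ) : ℂ)) := by
  have hgauss : ((Real.sqrt (6 / Real.pi) : ℝ) : ℂ) =
      ∫ u : ℝ, ((Real.exp (-(Real.pi ^ 2 / 6) * u ^ 2) : ℝ) : ℂ) := by
    rw [integral_complex_ofReal, integral_gaussian]
    congr 2
    field_simp
  have hpos : ∀ᶠ τ : ℝ in 𝓝[>] 0, 0 < τ := self_mem_nhdsWithin
  have hsmall : ∀ᶠ τ : ℝ in 𝓝[>] 0, τ ^ 2 ≤ 1 / 2 := by
    have : Tendsto (fun τ : ℝ ↦ τ ^ 2) (𝓝[>] 0) (𝓝 0) := by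
      simpa using ((continuous_pow 2 : Continuous fun τ : ℝ ↦ τ ^ 2).tendsto 0).mono_left
        nhdsWithin_le_nhds
    exact this.eventually_le_const (by norm_num)
  have hzero : ∀ᶠ τ : ℝ in 𝓝[>] 0, ‖scaledIntegrand τ 0‖ ≤ 2 := by
    refine (tendsto_scaledIntegrand 0).norm.eventually_le_const ?_
    simp
  have hmem : ∀ {τ u : ℝ}, 0 < τ → |τ ^ 3 * u| < Real.pi →
      u ∈ Set.Ioc (-Real.pi / τ ^ 3) (Real.pi / τ ^ 3) := by
    intro τ u hτ hu
    have hτ3 : 0 < τ ^ 3 := by positivity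
    rw [abs_lt] at hu
    exact ⟨by rw [div_lt_iff₀ hτ3]; linarith [hu.1], by rw [le_div_iff₀ hτ3]; linarith [hu.2]⟩
  have hmem' : ∀ {τ u : ℝ}, 0 < τ → u ∈ Set.Ioc (-Real.pi / τ ^ 3) (Real.pi / τ ^ 3) →
      |τ ^ 3 * u| ≤ Real.pi := by
    intro τ u hτ hu
    have hτ3 : 0 < τ ^ 3 := by positivity
    rw [Set.mem_Ioc, div_lt_iff₀ hτ3, le_div_iff₀ hτ3] at hu
    exact abs_le.mpr ⟨by linarith [hu.1], by linarith [hu.2]⟩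
  have hlim : Tendsto (fun τ : ℝ ↦ ∫ u : ℝ,
      (Set.Ioc (-Real.pi / τ ^ 3) (Real.pi / τ ^ 3)).indicator (scaledIntegrand τ) u)
      (𝓝[>] 0) (𝓝 (∫ u : ℝ, ((Real.exp (-(Real.pi ^ 2 / 6) * u ^ 2) : ℝ) : ℂ))) := by
    refine MeasureTheory.tendsto_integral_filter_of_dominated_convergence
      (fun u ↦ 2 * (25920 * (1 + u ^ 2)⁻¹)) ?_ ?_ ?_ ?_
    · filter_upwards [hpos] with τ hτ
      exact (continuous_scaledIntegrand hτ).aestronglyMeasurable.indicator measurableSet_Ioc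
    · filter_upwards [hpos, hsmall, hzero] with τ hτ h1 h2
      refine .of_forall fun u ↦ ?_
      by_cases hu : u ∈ Set.Ioc (-Real.pi / τ ^ 3) (Real.pi / τ ^ 3)
      · rw [Set.indicator_of_mem hu]
        refine (norm_scaledIntegrand_le hτ h1 (hmem' hτ hu)).trans ?_
        gcongr
      · rw [Set.indicator_of_notMem hu, norm_zero]
        positivity
    · exact (integrable_inv_one_add_sq.const_mul _).const_mul _
    · refine .of_forall fun u ↦ (tendsto_scaledIntegrand u).congr' ?_
      have : ∀ᶠ τ : ℝ in 𝓝[>] 0, |τ ^ 3 * u| < Real.pi := by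
        have hc : Continuous fun τ : ℝ ↦ |τ ^ 3 * u| := by fun_prop
        have ht : Tendsto (fun τ : ℝ ↦ |τ ^ 3 * u|) (𝓝[>] 0) (𝓝 0) := by
          simpa using (hc.tendsto 0).mono_left nhdsWithin_le_nhds
        exact ht.eventually_lt_const Real.pi_pos
      filter_upwards [hpos, this] with τ hτ hu
      rw [Set.indicator_of_mem (hmem hτ hu)]
  rw [hgauss]
  refine hlim.congr' ?_
  filter_upwards [hpos] with τ hτ
  have hle : -Real.pi / τ ^ 3 ≤ Real.pi / τ ^ 3 := by
    gcongr
    linarith [Real.pi_pos]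
  rw [intervalIntegral.integral_of_le hle, MeasureTheory.integral_indicator measurableSet_Ioc]

/-! ### The asymptotic formula -/

/-- Cauchy's formula on the circle through the saddle point, in the scaled variable. -/
theorem partitionCount_eq_integral {τ : ℝ} (hτ : 0 < τ) {n : ℕ}
    (hn : (n : ℝ) = Real.pi ^ 2 / (6 * τ ^ 4)) :
    (partitionCount n : ℂ) = ((τ ^ 4 / (2 * Real.pi * Real.sqrt (2 * Real.pi)) *
      Real.exp (Real.pi ^ 2 / (3 * τ ^ 2)) : ℝ) : ℂ) *
      ∫ u in (-Real.pi / τ ^ 3)..(Real.pi / τ ^ 3), scaledIntegrand τ u := by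
  have h := integral_inv_eulerPhi (by positivity : 0 < τ ^ 2) n
  set f : ℝ → ℂ := fun θ ↦
    (eulerPhi (Complex.exp (-(((τ ^ 2 : ℝ) : ℂ) + (θ : ℂ) * Complex.I))))⁻¹ *
      Complex.exp (n * (((τ ^ 2 : ℝ) : ℂ) + (θ : ℂ) * Complex.I)) with hf
  have hcomp := intervalIntegral.integral_comp_mul_left f (c := τ ^ 3) (by positivity)
    (a := -Real.pi / τ ^ 3) (b := Real.pi / τ ^ 3)
  rw [mul_div_cancel₀ _ (by positivity), mul_div_cancel₀ _ (by positivity), h] at hcomp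
  have hfu : ∀ u, scaledIntegrand τ u = f (τ ^ 3 * u) *
      (((τ / Real.sqrt (2 * Real.pi) * Real.exp (Real.pi ^ 2 / (3 * τ ^ 2)) : ℝ) : ℂ))⁻¹ := by
    intro u
    rw [scaledIntegrand, div_eq_mul_inv, ← hn]
    simp only [hf, scaledPoint, Complex.ofReal_natCast]
  simp only [hfu]
  rw [intervalIntegral.integral_mul_const, hcomp, Complex.real_smul]
  have h1 : (τ : ℂ) ≠ 0 := by exact_mod_cast hτ.ne'
  have h2 : (Real.pi : ℂ) ≠ 0 := by exact_mod_cast Real.pi_ne_zero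
  have h3 : ((Real.sqrt (2 * Real.pi) : ℝ) : ℂ) ≠ 0 := by
    exact_mod_cast (by positivity : Real.sqrt (2 * Real.pi) ≠ 0)
  have h4 : ((Real.exp (Real.pi ^ 2 / (3 * τ ^ 2)) : ℝ) : ℂ) ≠ 0 := by
    exact_mod_cast (Real.exp_pos _).ne'
  simp only [Complex.ofReal_mul, Complex.ofReal_div, Complex.ofReal_inv, Complex.ofReal_pow,
    Complex.ofReal_ofNat]
  generalize ((Real.exp (Real.pi ^ 2 / (3 * τ ^ 2)) : ℝ) : ℂ) = E at h4 ⊢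
  generalize ((Real.sqrt (2 * Real.pi) : ℝ) : ℂ) = S at h3 ⊢
  field_simp

theorem theorem4p1 :
    Filter.Tendsto
      (fun n : ℕ => (partitionCount n : ℝ) /
        (1 / (4 * (n : ℝ) * Real.sqrt 3) * Real.exp (Real.pi * Real.sqrt (2 * (n : ℝ) / 3))))
      Filter.atTop (nhds 1) := by
  -- The saddle point for `n` is `τ² = π / √(6 n)`.
  set t : ℕ → ℝ := fun n ↦ Real.sqrt (Real.sqrt (Real.pi ^ 2 / (6 * n))) with ht
  have htpos : ∀ n : ℕ, 0 < n → 0 < t n := by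
    intro n hn
    simp only [ht]
    positivity
  have ht2 : ∀ n, t n ^ 2 = Real.sqrt (Real.pi ^ 2 / (6 * n)) := fun n ↦
    Real.sq_sqrt (Real.sqrt_nonneg _)
  have ht4 : ∀ n, t n ^ 4 = Real.pi ^ 2 / (6 * n) := by
    intro n
    rw [show t n ^ 4 = (t n ^ 2) ^ 2 by ring, ht2, Real.sq_sqrt (by positivity)]
  have htlim : Tendsto t atTop (𝓝[>] 0) := by
    refine tendsto_nhdsWithin_iff.mpr ⟨?_, ?_⟩
    · have h : Tendsto (fun n : ℕ ↦ Real.pi ^ 2 / (6 * (n : ℝ))) atTop (𝓝 0) :=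
        tendsto_const_nhds.div_atTop
          (tendsto_natCast_atTop_atTop.const_mul_atTop (by norm_num))
      have h' := h.sqrt.sqrt
      rwa [Real.sqrt_zero, Real.sqrt_zero] at h'
    · filter_upwards [eventually_gt_atTop 0] with n hn using htpos n hn
  have hlim := ((Complex.continuous_re.tendsto _).comp
    (tendsto_integral_scaledIntegrand.comp htlim)).const_mul (Real.sqrt (Real.pi / 6))
  have hone : Real.sqrt (Real.pi / 6) * (((Real.sqrt (6 / Real.pi) : ℝ) : ℂ)).re = 1 := by
    rw [Complex.ofReal_re, ← Real.sqrt_mul (by positivity)]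
    field_simp
    simp
  rw [hone] at hlim
  refine hlim.congr' ?_
  filter_upwards [eventually_gt_atTop 0] with n hn
  have hn' : (0 : ℝ) < n := by exact_mod_cast hn
  have hp := partitionCount_eq_integral (htpos n hn) (n := n) (by rw [ht4]; field_simp)
  have hp' := congrArg Complex.re hp
  rw [Complex.re_ofReal_mul, Complex.natCast_re] at hp'
  have hexp : Real.pi ^ 2 / (3 * t n ^ 2) = Real.pi * Real.sqrt (2 * (n : ℝ) / 3) := by
    have h1 : t n ^ 2 * Real.sqrt (2 * (n : ℝ) / 3) = Real.pi / 3 := by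
      rw [ht2, ← Real.sqrt_mul (by positivity), Real.sqrt_eq_iff_mul_self_eq (by positivity)
        (by positivity)]
      field_simp
      norm_num
    have := pow_pos (htpos n hn) 2
    rw [div_eq_iff (by positivity)]
    linear_combination (-3 * Real.pi) * h1
  have hconst : Real.sqrt (Real.pi / 6) =
      t n ^ 4 / (2 * Real.pi * Real.sqrt (2 * Real.pi)) * (4 * n * Real.sqrt 3) := by
    rw [ht4, Real.sqrt_eq_iff_mul_self_eq (by positivity) (by positivity)]
    have h3 := Real.sq_sqrt (show (0 : ℝ) ≤ 3 by norm_num)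
    have h2 := Real.sq_sqrt (show 0 ≤ Real.pi * 2 by positivity)
    field_simp
    rw [h3, h2]
    ring
  simp only [Function.comp_apply]
  rw [hp', hexp, hconst]
  field_simp
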